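/- Let $H$ be a separable complex Hilbert space and let $A$ be a (possibly unbounded) positive self-adjoint operator on $H$ that is invertible, i.e. it maps its domain bijectively onto $H$, so that $A^{-1}$ is a bounded operator. Let $\{e^{-tA}\}_{t\ge 0}$ be the $C_0$-semigroup generated by $A$. For a compact operator $T$ on $H$ let $s_1(T)\ge s_2(T)\ge\dots\ge 0$ be its singular values, i.e. the square roots of the eigenvalues of $T^*T$ counted with multiplicity (followed by zeros if there are only finitely many nonzero ones). Put $\operatorname{Tr}|T|^q=\sum_k s_k(T)^q\in[0,\infty]$ for $q>0$ and $\|T\|_1=\sum_k s_k(T)\in[0,\infty]$, with the value $\infty$ for bounded operators that are not compact. Let $$\mathcal Z_1=\Big\{T \text{ compact}: \limsup_{q\downarrow 1}\big((q-1)\operatorname{Tr}|T|^q\big)^{1/q}<\infty\Big\},\qquad \mathcal M^{1,\infty}=\Big\{T \text{ compact}: \sum_{k=1}^n s_k(T)=O(\ln(1+n)) \text{ as } n\to\infty\Big\}.$$ (i) If $A^{-1}\in\mathcal Z_1$, then for every $t>0$ the operators $e^{-tA}$ and $A^{-1}e^{-tA}$ are trace class, and $t\mapsto-\|A^{-1}e^{-tA}\|_1$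 is a primitive of $t\mapsto\|e^{-tA}\|_1$ on $(0,\infty)$, i.e. it is differentiable there with derivative $\|e^{-tA}\|_1$. (ii) $\mathcal Z_1=\mathcal M^{1,\infty}$, and $A^{-1}\in\mathcal Z_1$ if and only if $\|A^{-1}e^{-tA}\|_1=O(\ln t^{-1})$ as $t\downarrow 0$ (in particular $\|A^{-1}e^{-tA}\|_1$ is finite for all sufficiently small $t>0$). -/

import Mathlib

open Filter Topology
open scoped ENNReal InnerProductSpace

namespace GibbsSemigroup

noncomputable section

/-! ### Singular values, trace norm, and the ideals `𝒵_p` and `𝓜^{p,∞}` -/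

section Ideals

variable {H : Type*} [NormedAddCommGroup H] [InnerProductSpace ℂ H] [CompleteSpace H]

/-- The sum of the eigenspaces of `T* T` for the eigenvalues `μ ≥ s²`. For compact `T` and `s > 0`
it is finite-dimensional, and its dimension is the number of singular values of `T` (counted with
multiplicity) that are at least `s`. -/
def upperEigenspace (T : H →L[ℂ] H) (s : ℝ) : Submodule ℂ H :=
  ⨆ μ : {μ : ℝ // s ^ 2 ≤ μ},
    Module.End.eigenspace ((ContinuousLinearMap.adjoint T ∘L T : H →L[ℂ] H) : H →ₗ[ℂ] H)
      ((μ : ℝ) : ℂ)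

/-- The `k`-th singular value (`k = 0, 1, 2, …`) of a compact operator `T`: the square root of the
`k`-th eigenvalue of `T* T`, where the eigenvalues are arranged in non-increasing order and
repeated according to multiplicity. It is `0` if there are at most `k` nonzero eigenvalues. -/
def singularValue (T : H →L[ℂ] H) (k : ℕ) : ℝ :=
  sSup {s : ℝ | 0 < s ∧ k < Module.finrank ℂ (upperEigenspace T s)}

/-- `Tr |T|^q = ∑_k s_k(T)^q ∈ [0, ∞]` for compact `T` and `q > 0`; a bounded operator that is
not compact is given the value `∞`. -/
def trAbsPow (T : H →L[ℂ] H) (q : ℝ) : ℝ≥0∞ :=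
  open Classical in
  if IsCompactOperator T then ∑' k : ℕ, ENNReal.ofReal (singularValue T k ^ q) else ∞

/-- The trace norm `‖T‖₁ = ∑_k s_k(T) ∈ [0, ∞]`, finite exactly on the trace class. -/
def traceNorm (T : H →L[ℂ] H) : ℝ≥0∞ := trAbsPow T 1

variable (H) in
/-- `𝒵_p`: the compact operators with `limsup_{q ↓ p} ((q - p) Tr |T|^q)^{1/q} < ∞`. -/
def zIdeal (p : ℝ) : Set (H →L[ℂ] H) :=
  {T | IsCompactOperator T ∧
    limsup (fun q : ℝ => (ENNReal.ofReal (q - p) * trAbsPow T q) ^ (1 / q)) (𝓝[>] p) < ∞}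

variable (H) in
/-- The Lorentz ideal `𝓜^{p,∞}`: the compact operators whose singular values satisfy
`∑_{k < n} s_k(T)^p = O(ln (1 + n))` as `n → ∞`. -/
def lorentzIdeal (p : ℝ) : Set (H →L[ℂ] H) :=
  {T | IsCompactOperator T ∧
    (fun n : ℕ => ∑ k ∈ Finset.range n, singularValue T k ^ p) =O[atTop]
      fun n : ℕ => Real.log (1 + n)}

end Ideals

/-! ### The inverse of a self-adjoint operator and the semigroup it generates -/

section Semigroup

variable {H : Type*} [NormedAddCommGroup H] [InnerProductSpace ℂ H]

/-- The (unbounded) operator `A` is positive: `⟨A x, x⟩ ≥ 0` on its domain. -/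
def IsPositive (A : H →ₗ.[ℂ] H) : Prop :=
  ∀ x : A.domain, 0 ≤ (⟪A x, (x : H)⟫_ℂ).re

/-- The inverse, as a linear map on `H`, of an operator that maps its domain bijectively
onto `H`. -/
def invLM (A : H →ₗ.[ℂ] H) (hbij : Function.Bijective A) : H →ₗ[ℂ] H :=
  A.domain.subtype ∘ₗ (LinearEquiv.ofBijective A.toFun hbij).symm.toLinearMap

theorem invLM_mem (A : H →ₗ.[ℂ] H) (hbij : Function.Bijective A) (y : H) :
    invLM A hbij y ∈ A.domain :=
  ((LinearEquiv.ofBijective A.toFun hbij).symm y).2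

theorem apply_invLM (A : H →ₗ.[ℂ] H) (hbij : Function.Bijective A) (y : H) :
    A ⟨invLM A hbij y, invLM_mem A hbij y⟩ = y :=
  (LinearEquiv.ofBijective A.toFun hbij).apply_symm_apply y

theorem invLM_apply (A : H →ₗ.[ℂ] H) (hbij : Function.Bijective A) (x : A.domain) :
    invLM A hbij (A x) = x :=
  congrArg Subtype.val ((LinearEquiv.ofBijective A.toFun hbij).symm_apply_apply x)

variable [CompleteSpace H]

theorem inner_apply_left (A : H →ₗ.[ℂ] H) (hA : IsSelfAdjoint A) (x y : A.domain) :
    ⟪A x, (y : H)⟫_ℂ = ⟪(x : H), A y⟫_ℂ := by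
  have h := LinearPMap.adjoint_isFormalAdjoint (T := A) hA.dense_domain
  rw [LinearPMap.isSelfAdjoint_def.1 hA] at h
  exact h x y

theorem invLM_isSymmetric (A : H →ₗ.[ℂ] H) (hA : IsSelfAdjoint A)
    (hbij : Function.Bijective A) : (invLM A hbij).IsSymmetric := by
  intro x y
  have h := inner_apply_left A hA ⟨_, invLM_mem A hbij x⟩ ⟨_, invLM_mem A hbij y⟩
  rw [apply_invLM, apply_invLM] at h
  exact h.symm

/-- The bounded inverse `A⁻¹` of a self-adjoint operator `A` that maps its domain bijectively
onto `H`; it is bounded by the Hellinger-Toeplitz theorem. -/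
def inv (A : H →ₗ.[ℂ] H) (hA : IsSelfAdjoint A) (hbij : Function.Bijective A) : H →L[ℂ] H :=
  ⟨invLM A hbij, (invLM_isSymmetric A hA hbij).continuous⟩

/-- The function `x ↦ e^{-t/x}` on `[0, ∞)`, extended by `0` at `x = 0`. -/
def expNegDiv (t x : ℝ) : ℝ := if x = 0 then 0 else Real.exp (-t / x)

/-- The operator `e^{-tA}`, `t ≥ 0`, for a positive self-adjoint invertible `A`, defined by
functional calculus: `e^{-tλ}` is the function `e^{-t/x}` of `x = λ⁻¹`, applied to `A⁻¹`.
That this is the `C₀`-semigroup generated by `A` is `expNeg_isGeneratedBy` below. -/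
def expNeg (A : H →ₗ.[ℂ] H) (hA : IsSelfAdjoint A) (hbij : Function.Bijective A) (t : ℝ) :
    H →L[ℂ] H :=
  if t = 0 then 1 else cfc (expNegDiv t) (inv A hA hbij)

/-- `U` is a `C₀`-semigroup of bounded operators and `A` is its generator, in the convention
`U t = e^{-tA}`: `x` is in the domain of `A` with `A x = y` if and only if
`(x - U t x) / t → y` as `t ↓ 0`. -/
structure IsGeneratedBy (U : ℝ → H →L[ℂ] H) (A : H →ₗ.[ℂ] H) : Prop where
  map_zero : U 0 = 1
  map_add : ∀ s t : ℝ, 0 ≤ s → 0 ≤ t → U (s + t) = U s ∘L U t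
  tendsto_zero : ∀ x : H, Tendsto (fun t => U t x) (𝓝[>] 0) (𝓝 x)
  generator : ∀ x y : H,
    (x, y) ∈ A.graph ↔ Tendsto (fun t : ℝ => t⁻¹ • (x - U t x)) (𝓝[>] 0) (𝓝 y)

theorem inv_isSelfAdjoint (A : H →ₗ.[ℂ] H) (hA : IsSelfAdjoint A)
    (hbij : Function.Bijective A) : IsSelfAdjoint (inv A hA hbij) :=
  (ContinuousLinearMap.isSelfAdjoint_iff_isSymmetric).2 (invLM_isSymmetric A hA hbij)

theorem inv_nonneg (A : H →ₗ.[ℂ] H) (hA : IsSelfAdjoint A) (hpos : IsPositive A)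
    (hbij : Function.Bijective A) : 0 ≤ inv A hA hbij := by
  rw [ContinuousLinearMap.nonneg_iff_isPositive, ContinuousLinearMap.isPositive_def']
  refine ⟨inv_isSelfAdjoint A hA hbij, fun y => ?_⟩
  have h := hpos ⟨_, invLM_mem A hbij y⟩
  rw [apply_invLM] at h
  rw [ContinuousLinearMap.reApplyInnerSelf, ← inner_conj_symm]
  exact h.trans_eq (Complex.conj_re _).symm

theorem spectrum_inv_nonneg (A : H →ₗ.[ℂ] H) (hA : IsSelfAdjoint A) (hpos : IsPositive A)
    (hbij : Function.Bijective A) : ∀ x ∈ spectrum ℝ (inv A hA hbij), 0 ≤ x :=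
  fun _ hx => spectrum_nonneg_of_nonneg (inv_nonneg A hA hpos hbij) hx

theorem expNegDiv_bounds {t x : ℝ} (ht : 0 < t) (hx : 0 ≤ x) :
    0 ≤ expNegDiv t x ∧ expNegDiv t x ≤ 1 := by
  unfold expNegDiv
  split_ifs with h
  · simp
  · refine ⟨(Real.exp_pos _).le, Real.exp_le_one_iff.2 ?_⟩
    rw [neg_div]
    exact neg_nonpos.2 (by positivity)

theorem continuousOn_expNegDiv {t : ℝ} (ht : 0 < t) :
    ContinuousOn (expNegDiv t) (Set.Ici 0) := by
  intro x hx
  rcases eq_or_lt_of_le (show (0 : ℝ) ≤ x from hx) with rfl | hx0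
  · have h1 : Tendsto (fun x : ℝ => Real.exp (-t / x)) (𝓝[>] 0) (𝓝 0) := by
      refine Real.tendsto_exp_atBot.comp ?_
      exact (tendsto_inv_nhdsGT_zero (𝕜 := ℝ)).const_mul_atTop_of_neg (neg_lt_zero.2 ht)
    rw [← continuousWithinAt_Ioi_iff_Ici, ContinuousWithinAt]
    have h0 : expNegDiv t 0 = 0 := if_pos rfl
    rw [h0]
    refine h1.congr' ?_
    filter_upwards [self_mem_nhdsWithin] with y hy
    exact (if_neg (ne_of_gt hy)).symm
  · refine ContinuousAt.continuousWithinAt ?_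
    have : ContinuousAt (fun x : ℝ => Real.exp (-t / x)) x := by
      have := hx0.ne'
      fun_prop (disch := assumption)
    refine this.congr ?_
    filter_upwards [lt_mem_nhds hx0] with y hy
    exact (if_neg (ne_of_gt hy)).symm

/-- The function `(x - x e^{-t/x}) / t` takes values in `[0, 1]`, and its distance to `1` is
at most `t / (2 x)`. -/
theorem quotient_bounds {t x : ℝ} (ht : 0 < t) (hx : 0 ≤ x) :
    |t⁻¹ * (x - x * expNegDiv t x)| ≤ 1 ∧
      |(t⁻¹ * (x - x * expNegDiv t x) - 1) * x| ≤ t := by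
  rcases hx.eq_or_lt with rfl | hx
  · simp [ht.le]
  have he : expNegDiv t x = Real.exp (-t / x) := if_neg hx.ne'
  rw [he]
  have h1 : -t / x + 1 ≤ Real.exp (-t / x) := Real.add_one_le_exp _
  have h2 : Real.exp (-t / x) ≤ 1 := he ▸ (expNegDiv_bounds ht hx.le).2
  have hu : x * (t / x) = t := by field_simp
  have h3 : Real.exp (-t / x) * (1 + t / x) ≤ 1 := by
    have h4 : t / x + 1 ≤ Real.exp (t / x) := Real.add_one_le_exp _
    calc Real.exp (-t / x) * (1 + t / x) ≤ Real.exp (-t / x) * Real.exp (t / x) := by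
          gcongr; linarith
      _ = 1 := by rw [← Real.exp_add]; simp [neg_div]
  set e := Real.exp (-t / x) with hedef
  have hle : x - x * e ≤ t := by
    have := mul_le_mul_of_nonneg_left h1 hx.le
    have e1 : x * (-t / x + 1) = x - t := by field_simp; ring
    linarith
  have hge : 0 ≤ x - x * e := by nlinarith
  have hkey : e * (x + t) ≤ x := by
    have := mul_le_mul_of_nonneg_left h3 hx.le
    have e1 : x * (e * (1 + t / x)) = e * (x + x * (t / x)) := by ring
    rw [e1, hu] at this
    linarith
  constructor
  · rw [abs_le]
    constructor
    · have : 0 ≤ t⁻¹ * (x - x * e) := by positivity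
      linarith
    · rw [inv_mul_le_iff₀ ht]; linarith
  · have e2 : (t⁻¹ * (x - x * e) - 1) * x = t⁻¹ * ((x - x * e - t) * x) := by field_simp
    rw [e2, abs_mul, abs_of_pos (inv_pos.2 ht), inv_mul_le_iff₀ ht,
      abs_of_nonpos (mul_nonpos_of_nonpos_of_nonneg (by linarith) hx.le)]
    have he0 : 0 < e := Real.exp_pos _
    have hxe : x * x - x * x * e ≥ x * (e * t) := by nlinarith
    have ht1 : x * (1 - e) ≤ t := by linarith
    have : t * x - t * x * e ≤ t * t := by nlinarith
    nlinarith

/-- `e^{-tA}`, as defined above, is the `C₀`-semigroup generated by `A`. -/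
theorem expNeg_isGeneratedBy (A : H →ₗ.[ℂ] H) (hA : IsSelfAdjoint A) (hpos : IsPositive A)
    (hbij : Function.Bijective A) : IsGeneratedBy (expNeg A hA hbij) A := by
  set B := inv A hA hbij with hB
  set U := expNeg A hA hbij with hU
  have hBsa : IsSelfAdjoint B := inv_isSelfAdjoint A hA hbij
  have hsp : ∀ x ∈ spectrum ℝ B, 0 ≤ x := spectrum_inv_nonneg A hA hpos hbij
  have hsub : spectrum ℝ B ⊆ Set.Ici 0 := hsp
  have hUt : ∀ t : ℝ, 0 < t → U t = cfc (expNegDiv t) B := fun t ht => if_neg ht.ne'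
  have hU0 : U 0 = 1 := if_pos rfl
  have hcont : ∀ t : ℝ, 0 < t → ContinuousOn (expNegDiv t) (spectrum ℝ B) := fun t ht =>
    (continuousOn_expNegDiv ht).mono hsub
  have hcomp : ∀ S T : H →L[ℂ] H, S ∘L T = S * T := fun _ _ => rfl
  -- the difference quotients, as functions of `B`
  have hQcont : ∀ t : ℝ, 0 < t →
      ContinuousOn (fun x => t⁻¹ * (x - x * expNegDiv t x)) (spectrum ℝ B) := fun t ht => by
    have := hcont t ht
    fun_prop
  have hQ : ∀ t : ℝ, 0 < t →
      cfc (fun x => t⁻¹ * (x - x * expNegDiv t x)) B = t⁻¹ • (B - B * U t) := by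
    intro t ht
    have hc := hcont t ht
    rw [cfc_const_mul t⁻¹ (fun x => x - x * expNegDiv t x) B (by fun_prop),
      cfc_sub (fun x => x) (fun x => x * expNegDiv t x) B (by fun_prop) (by fun_prop),
      cfc_mul (fun x => x) (expNegDiv t) B (by fun_prop) hc, cfc_id' ℝ B, hUt t ht]
  have hQ1 : ∀ t : ℝ, 0 < t → ‖t⁻¹ • (B - B * U t)‖ ≤ 1 := fun t ht => by
    rw [← hQ t ht]
    exact norm_cfc_le zero_le_one fun x hx => (quotient_bounds ht (hsp x hx)).1
  have hQ2 : ∀ t : ℝ, 0 < t → ‖(t⁻¹ • (B - B * U t) - 1) * B‖ ≤ t := fun t ht => by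
    have hc := hQcont t ht
    have : cfc (fun x => (t⁻¹ * (x - x * expNegDiv t x) - 1) * x) B
        = (t⁻¹ • (B - B * U t) - 1) * B := by
      rw [cfc_mul (fun x => t⁻¹ * (x - x * expNegDiv t x) - 1) (fun x => x) B (by fun_prop)
        (by fun_prop), cfc_sub (fun x => t⁻¹ * (x - x * expNegDiv t x)) (fun _ => 1) B hc
        (by fun_prop), hQ t ht, cfc_id' ℝ B, cfc_const_one ℝ B]
    rw [← this]
    exact norm_cfc_le ht.le fun x hx => (quotient_bounds ht (hsp x hx)).2
  have hU1 : ∀ t : ℝ, 0 < t → ‖U t‖ ≤ 1 := fun t ht => by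
    rw [hUt t ht]
    refine norm_cfc_le zero_le_one fun x hx => ?_
    have := expNegDiv_bounds ht (hsp x hx)
    rw [Real.norm_eq_abs, abs_of_nonneg this.1]
    exact this.2
  have hcomm : ∀ t : ℝ, 0 < t → B * U t = U t * B := fun t ht => by
    rw [hUt t ht]
    exact (cfc_commute_cfc (fun x : ℝ => x) (expNegDiv t) B |>.eq |> fun h => by
      rwa [cfc_id' ℝ B] at h)
  have hrange : ∀ x : A.domain, B (A x) = x := fun x => invLM_apply A hbij x
  have hdense : DenseRange B := by
    refine hA.dense_domain.mono fun x hx => ⟨A ⟨x, hx⟩, hrange ⟨x, hx⟩⟩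
  -- strong convergence of uniformly bounded families, tested on the range of `B`
  have hstrong : ∀ V : ℝ → H →L[ℂ] H, (∀ t, 0 < t → ‖V t‖ ≤ 1) →
      (∀ z, Tendsto (fun t => V t (B z)) (𝓝[>] 0) (𝓝 (B z))) →
      ∀ x, Tendsto (fun t => V t x) (𝓝[>] 0) (𝓝 x) := by
    intro V hV hVB x
    rw [Metric.tendsto_nhds]
    intro ε hε
    obtain ⟨z, hz⟩ := hdense.exists_dist_lt x (show 0 < ε / 3 by positivity)
    filter_upwards [(Metric.tendsto_nhds.1 (hVB z)) (ε / 3) (by positivity),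
      self_mem_nhdsWithin] with t h1 ht
    have h2 : dist (V t x) (V t (B z)) ≤ dist x (B z) := by
      rw [dist_eq_norm, dist_eq_norm, ← map_sub]
      exact ((V t).le_of_opNorm_le (hV t ht) _).trans (one_mul _).le
    calc dist (V t x) x ≤ dist (V t x) (V t (B z)) + dist (V t (B z)) (B z) + dist (B z) x :=
          dist_triangle4 _ _ _ _
      _ < ε := by rw [dist_comm (B z) x]; linarith
  have hQlim : ∀ y : H,
      Tendsto (fun t : ℝ => (t⁻¹ • (B - B * U t)) y) (𝓝[>] 0) (𝓝 y) := by
    refine hstrong (fun t : ℝ => t⁻¹ • (B - B * U t)) hQ1 fun z => ?_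
    rw [tendsto_iff_norm_sub_tendsto_zero]
    refine squeeze_zero' (Eventually.of_forall fun _ => norm_nonneg _)
      (g := fun t : ℝ => t * ‖z‖) ?_ ?_
    · filter_upwards [self_mem_nhdsWithin] with t ht
      exact ((t⁻¹ • (B - B * U t) - 1) * B).le_of_opNorm_le (hQ2 t ht) z
    · have : Tendsto (fun t : ℝ => t * ‖z‖) (𝓝 0) (𝓝 (0 * ‖z‖)) := by
        exact tendsto_id.mul_const _
      rw [zero_mul] at this
      exact this.mono_left nhdsWithin_le_nhds
  have hquot : ∀ y : H,
      Tendsto (fun t : ℝ => t⁻¹ • (B y - U t (B y))) (𝓝[>] 0) (𝓝 y) := fun y => by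
    refine (hQlim y).congr' ?_
    filter_upwards [self_mem_nhdsWithin] with t ht
    rw [hcomm t ht]
    rfl
  refine ⟨hU0, ?_, ?_, ?_⟩
  · intro s t hs ht
    rcases hs.eq_or_lt with rfl | hs
    · rw [hU0, zero_add]; rfl
    rcases ht.eq_or_lt with rfl | ht
    · rw [hU0, add_zero]; rfl
    rw [hcomp, hUt s hs, hUt t ht, hUt _ (add_pos hs ht),
      ← cfc_mul (expNegDiv s) (expNegDiv t) B (hcont s hs) (hcont t ht)]
    congr 1
    funext x
    unfold expNegDiv
    split_ifs
    · simp
    · rw [← Real.exp_add]; congr 1; ring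
  · refine hstrong U hU1 fun z => ?_
    have h0 : Tendsto (fun t : ℝ => t) (𝓝[>] 0) (𝓝 0) := tendsto_id.mono_left nhdsWithin_le_nhds
    have h1 := (h0.smul (hquot z)).const_sub (B z)
    rw [zero_smul, sub_zero] at h1
    refine h1.congr' ?_
    filter_upwards [self_mem_nhdsWithin] with t ht
    rw [smul_smul, mul_inv_cancel₀ (ne_of_gt ht), one_smul, sub_sub_cancel]
  · intro x y
    constructor
    · intro h
      obtain ⟨x', hx, hy⟩ := (LinearPMap.mem_graph_iff A).1 h
      have h2 := hquot (A x')
      rw [hrange x'] at h2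
      simp only at hx hy
      rw [hx, hy] at h2
      exact h2
    · intro h
      have h1 := (B.continuous.tendsto y).comp h
      have h2 : Tendsto (fun t : ℝ => B (t⁻¹ • (x - U t x))) (𝓝[>] 0) (𝓝 x) := by
        refine (hQlim x).congr fun t => ?_
        have e : B (t⁻¹ • (x - U t x)) = t⁻¹ • B (x - U t x) :=
          (B.restrictScalars ℝ).map_smul t⁻¹ _
        rw [e, map_sub]
        rfl
      have hxy : B y = x := tendsto_nhds_unique h1 h2
      rw [LinearPMap.mem_graph_iff]
      exact ⟨⟨B y, invLM_mem A hbij y⟩, hxy, apply_invLM A hbij y⟩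

end Semigroup

end

end GibbsSemigroup

/-!
Write `B = A⁻¹`, a bounded positive operator, so that `e^{-tA}` and `A⁻¹ e^{-tA}` are the functions
`e^{-t/x}` and `x e^{-t/x}` of `B`. Both functions are continuous and strictly increasing on `[0, ∞)`
and vanish at `0`. Such a function `f` of `B` has the same eigenvectors as `B`, hence
`s_k(f(B)) = f(s_k(B))` (`singularValue_cfc`), and for compact `B` the trace norms become the sums
`‖e^{-tA}‖₁ = ∑ e^{-t/a_k}` and `‖A⁻¹ e^{-tA}‖₁ = ∑ a_k e^{-t/a_k}` with `a_k = s_k(B)`. The rest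
concerns a nonincreasing nonnegative sequence `a`.

The three growth conditions are equivalent by a cycle of implications.

* `∑ a_k^q = O(1/(q - 1))` implies `∑ a_k e^{-t/a_k} = O(ln t⁻¹)`, because
  `x e^{-t/x} ≤ t^{1-q} x^q` and one may take `q = 1 + 1/ln t⁻¹` (`PowerSumBound.heatSumBound`).
* This implies `∑_{k<n} a_k = O(ln (1 + n))`, because `x ≤ e x e^{-t/x} + t` and one may take
  `t = 1/(1 + n)` (`HeatSumBound.sum_isBigO`).
* This implies the first condition: `a` is weakly majorized by a multiple of `1/(k + 1)`, so its
  `q`-th power sums are at most a constant times `ζ(q)` (`powerSumBound_of_sum_isBigO`).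

Under the first condition both sums converge for every `t > 0`, and the series
`-∑ a_k e^{-t/a_k}` can be differentiated term by term (`PowerSumBound.hasDerivAt_tsum`).
For the converse half of the criterion by trace norms, `B` has to be shown compact: it is the norm
limit of `B e^{-tA}` as `t ↓ 0` (`tendsto_mul_cfc_expNegDiv`).
-/

namespace GibbsSemigroup

/-! ### Eigenvectors and the continuous functional calculus -/

section FunctionalCalculus

variable {H : Type*} [NormedAddCommGroup H] [InnerProductSpace ℂ H] [CompleteSpace H]

/-- The set of functions `g` with `g(B) x = g(l) x` is a closed subalgebra of the continuous
functions on the spectrum that contains the identity, so by Stone-Weierstrass it is everything. -/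
theorem cfc_apply_eq_smul {B : H →L[ℂ] H} (hB : IsSelfAdjoint B) {l : ℝ} (hl : l ∈ spectrum ℝ B)
    {x : H} (hx : B x = l • x) {f : ℝ → ℝ} (hf : ContinuousOn f (spectrum ℝ B)) :
    cfc f B x = f l • x := by
  rw [cfc_apply f B hB hf]
  suffices h : ∀ g : C(spectrum ℝ B, ℝ), cfcHom hB g x = g ⟨l, hl⟩ • x from h ⟨_, hf.domRestrict⟩
  intro g
  refine ContinuousMap.induction_on_of_compact (p := fun g => cfcHom hB g x = g ⟨l, hl⟩ • x)
    ?_ ?_ ?_ ?_ ?_ ?_ g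
  · intro r
    have : cfcHom hB (ContinuousMap.const _ r) = algebraMap ℝ (H →L[ℂ] H) r :=
      AlgHomClass.commutes (cfcHom hB) r
    rw [this, Algebra.algebraMap_eq_smul_one]
    rfl
  · rw [cfcHom_id hB]
    exact hx
  · rw [map_star, cfcHom_id hB, hB.star_eq]
    exact hx
  · intro f g hf hg
    rw [map_add, add_apply, hf, hg, ContinuousMap.add_apply, add_smul]
  · intro f g hf hg
    rw [map_mul]
    change cfcHom hB f (cfcHom hB g x) = (f ⟨l, hl⟩ * g ⟨l, hl⟩) • x
    rw [hg, ContinuousLinearMap.map_smul_of_tower, hf, smul_smul, mul_comm]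
  · intro f hf
    have h1 : IsClosed {g : C(spectrum ℝ B, ℝ) | cfcHom hB g x = g ⟨l, hl⟩ • x} := by
      refine isClosed_eq ?_ ?_
      · exact (ContinuousLinearMap.apply ℂ H x).continuous.comp (cfcHom_continuous hB)
      · exact (continuous_eval_const (F := C(spectrum ℝ B, ℝ)) ⟨l, hl⟩).smul
          (continuous_const (y := x))
    exact h1.mem_of_frequently_of_tendsto hf tendsto_id

omit [CompleteSpace H] in
theorem mem_spectrum_of_apply_eq_smul {C : H →L[ℂ] H} {l : ℝ} {x : H} (hx0 : x ≠ 0)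
    (hx : C x = l • x) : l ∈ spectrum ℝ C := by
  rw [spectrum.mem_iff]
  rintro ⟨u, hu⟩
  have h1 : (u : H →L[ℂ] H) x = 0 := by
    rw [hu, sub_apply, hx, Algebra.algebraMap_eq_smul_one]
    exact sub_self _
  have h2 : ((↑u⁻¹ : H →L[ℂ] H) * u) x = x := by rw [Units.inv_mul]; rfl
  change (↑u⁻¹ : H →L[ℂ] H) ((u : H →L[ℂ] H) x) = x at h2
  rw [h1, map_zero] at h2
  exact hx0 h2.symm

/-- If `g` is continuous and injective on the (compact) spectrum of `B`, its inverse is continuous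
there, so `B` is in turn a continuous function of `g(B)`. -/
theorem exists_cfc_comp_eq_self {B : H →L[ℂ] H} (hB : IsSelfAdjoint B) {g : ℝ → ℝ}
    (hg : ContinuousOn g (spectrum ℝ B)) (hinj : Set.InjOn g (spectrum ℝ B)) :
    ∃ h : ℝ → ℝ, ContinuousOn h (g '' spectrum ℝ B) ∧ (∀ x ∈ spectrum ℝ B, h (g x) = x) ∧
      cfc h (cfc g B) = B := by
  set S := spectrum ℝ B with hS
  have hleft : ∀ x ∈ S, Function.invFunOn g S (g x) = x := hinj.leftInvOn_invFunOn
  have hemb : IsClosedEmbedding (S.domRestrict g) :=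
    hg.domRestrict.isClosedEmbedding (Set.injOn_iff_injective.1 hinj)
  have hmem : ∀ y : g '' S, Function.invFunOn g S y ∈ S := by
    rintro ⟨_, x, hx, rfl⟩
    rw [hleft x hx]
    exact hx
  have hcont : ContinuousOn (Function.invFunOn g S) (g '' S) := by
    rw [continuousOn_iff_continuous_domRestrict]
    have : Continuous fun y : g '' S => (⟨_, hmem y⟩ : S) := by
      rw [hemb.isInducing.continuous_iff]
      refine continuous_subtype_val.congr ?_
      rintro ⟨_, x, hx, rfl⟩
      exact congrArg g (hleft x hx).symm
    exact continuous_subtype_val.comp this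
  refine ⟨_, hcont, hleft, ?_⟩
  rw [← cfc_comp (Function.invFunOn g S) g B hB hcont hg]
  conv_rhs => rw [← cfc_id ℝ B]
  exact cfc_congr hleft

/-- A self-adjoint operator and an injective continuous function of it have the same
eigenvectors. -/
theorem cfc_apply_eq_smul_iff {B : H →L[ℂ] H} (hB : IsSelfAdjoint B) {g : ℝ → ℝ}
    (hg : ContinuousOn g (spectrum ℝ B)) (hinj : Set.InjOn g (spectrum ℝ B)) {l : ℝ}
    (hl : l ∈ spectrum ℝ B) {x : H} : cfc g B x = g l • x ↔ B x = l • x := by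
  refine ⟨fun h => ?_, fun h => cfc_apply_eq_smul hB hl h hg⟩
  obtain ⟨k, hk, hkg, hkB⟩ := exists_cfc_comp_eq_self hB hg hinj
  have hsp : spectrum ℝ (cfc g B) = g '' spectrum ℝ B := cfc_map_spectrum g B
  have := cfc_apply_eq_smul (cfc_predicate g B) (hsp ▸ Set.mem_image_of_mem g hl) h
    (f := k) (hsp ▸ hk)
  rwa [hkB, hkg l hl] at this

end FunctionalCalculus

/-! ### Singular values of monotone functions of a positive operator -/

section SingularValues

variable {H : Type*} [NormedAddCommGroup H] [InnerProductSpace ℂ H] [CompleteSpace H]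

omit [CompleteSpace H] in
theorem mem_eigenspace_ofReal {C : H →L[ℂ] H} {l : ℝ} {x : H} :
    x ∈ Module.End.eigenspace (C : H →ₗ[ℂ] H) (l : ℂ) ↔ C x = l • x := by
  rw [Module.End.mem_eigenspace_iff, Complex.coe_smul]
  rfl

theorem adjoint_comp_cfc {B : H →L[ℂ] H} {f : ℝ → ℝ}
    (hf : ContinuousOn f (spectrum ℝ B)) :
    (ContinuousLinearMap.adjoint (cfc f B) ∘L cfc f B : H →L[ℂ] H)
      = cfc (fun x => f x * f x) B := by
  rw [cfc_mul f f B hf hf, (show IsSelfAdjoint (cfc f B) from cfc_predicate f B).adjoint_eq]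
  rfl

variable {B : H →L[ℂ] H} {f : ℝ → ℝ}

theorem strictMonoOn_mul_self (hf : StrictMonoOn f (Set.Ici 0)) (hf0 : f 0 = 0) :
    StrictMonoOn (fun x => f x * f x) (Set.Ici 0) := fun x hx y hy hxy => by
  have h0 : 0 ≤ f x := hf0 ▸ hf.monotoneOn Set.self_mem_Ici hx hx
  exact mul_self_lt_mul_self h0 (hf hx hy hxy)

/-- The eigenvectors of `f(B)* f(B) = f²(B)` are eigenvectors of `B`. -/
theorem exists_of_mem_eigenspace (hB : 0 ≤ B) (hc : ContinuousOn f (Set.Ici 0))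
    (hf : StrictMonoOn f (Set.Ici 0)) (hf0 : f 0 = 0) {x : H} (hx0 : x ≠ 0) {m : ℝ}
    (hx : cfc (fun x => f x * f x) B x = m • x) :
    ∃ l, 0 ≤ l ∧ f l * f l = m ∧ B x = l • x := by
  have hsa : IsSelfAdjoint B := .of_nonneg hB
  have hsub : spectrum ℝ B ⊆ Set.Ici 0 := fun _ h => spectrum_nonneg_of_nonneg hB h
  have hcg : ContinuousOn (fun x => f x * f x) (spectrum ℝ B) := (hc.mul hc).mono hsub
  have hm := mem_spectrum_of_apply_eq_smul hx0 hx
  rw [cfc_map_spectrum (fun x => f x * f x) B hsa hcg] at hm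
  obtain ⟨l, hl, rfl⟩ := hm
  exact ⟨l, hsub hl, rfl, (cfc_apply_eq_smul_iff hsa hcg
    ((strictMonoOn_mul_self hf hf0).injOn.mono hsub) hl).1 hx⟩

/-- The space `upperEigenspace (f(B)) (f s)` is spanned by the eigenspaces of `B` itself for
eigenvalues `≥ s`; in particular it does not depend on `f`. -/
theorem upperEigenspace_cfc (hB : 0 ≤ B) (hc : ContinuousOn f (Set.Ici 0))
    (hf : StrictMonoOn f (Set.Ici 0)) (hf0 : f 0 = 0) {s : ℝ} (hs : 0 ≤ s) :
    upperEigenspace (cfc f B) (f s)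
      = ⨆ l : {l : ℝ // s ≤ l}, Module.End.eigenspace (B : H →ₗ[ℂ] H) ((l : ℝ) : ℂ) := by
  have hsa : IsSelfAdjoint B := .of_nonneg hB
  have hsub : spectrum ℝ B ⊆ Set.Ici 0 := fun _ h => spectrum_nonneg_of_nonneg hB h
  have hnn : ∀ x, 0 ≤ x → 0 ≤ f x := fun x hx => hf0 ▸ hf.monotoneOn Set.self_mem_Ici hx hx
  rw [upperEigenspace, adjoint_comp_cfc (hc.mono hsub)]
  refine le_antisymm (iSup_le ?_) (iSup_le ?_)
  · rintro ⟨m, hm⟩ x hx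
    rcases eq_or_ne x 0 with rfl | hx0
    · exact zero_mem _
    obtain ⟨l, hl, rfl, hBx⟩ :=
      exists_of_mem_eigenspace hB hc hf hf0 hx0 (mem_eigenspace_ofReal.1 hx)
    have hsl : s ≤ l := by
      rw [← hf.le_iff_le hs hl]
      nlinarith [hnn s hs, hnn l hl]
    exact Submodule.mem_iSup_of_mem ⟨l, hsl⟩ (mem_eigenspace_ofReal.2 hBx)
  · rintro ⟨l, hl⟩ x hx
    rcases eq_or_ne x 0 with rfl | hx0
    · exact zero_mem _
    have hBx := mem_eigenspace_ofReal.1 hx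
    have hle : f s ^ 2 ≤ f l * f l := by
      rw [sq]
      exact mul_self_le_mul_self (hnn s hs) (hf.monotoneOn hs (hs.trans hl) hl)
    refine Submodule.mem_iSup_of_mem ⟨_, hle⟩ (mem_eigenspace_ofReal.2 ?_)
    exact cfc_apply_eq_smul hsa (mem_spectrum_of_apply_eq_smul hx0 hBx) hBx
      ((hc.mul hc).mono hsub)

/-- A level `r` outside the range of `f` contributes nothing: `f(B)` has no singular values
above the supremum of `f`. -/
theorem exists_eq_of_upperEigenspace_cfc_ne_bot (hB : 0 ≤ B) (hc : ContinuousOn f (Set.Ici 0))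
    (hf : StrictMonoOn f (Set.Ici 0)) (hf0 : f 0 = 0) {r : ℝ} (hr : 0 < r)
    (h : upperEigenspace (cfc f B) r ≠ ⊥) : ∃ s, 0 < s ∧ f s = r := by
  have hsub : spectrum ℝ B ⊆ Set.Ici 0 := fun _ h => spectrum_nonneg_of_nonneg hB h
  have hnn : ∀ x, 0 ≤ x → 0 ≤ f x := fun x hx => hf0 ▸ hf.monotoneOn Set.self_mem_Ici hx hx
  rw [upperEigenspace, adjoint_comp_cfc (hc.mono hsub), Ne, iSup_eq_bot, not_forall] at h
  obtain ⟨⟨m, hm⟩, h⟩ := h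
  obtain ⟨x, hx, hx0⟩ := Submodule.exists_mem_ne_zero_of_ne_bot h
  obtain ⟨l, hl, rfl, -⟩ :=
    exists_of_mem_eigenspace hB hc hf hf0 hx0 (mem_eigenspace_ofReal.1 hx)
  have hrl : r ≤ f l := by nlinarith [hnn l hl]
  obtain ⟨s, hs, rfl⟩ := intermediate_value_Icc hl (hc.mono Set.Icc_subset_Ici_self)
    (show r ∈ Set.Icc (f 0) (f l) from ⟨hf0.trans_le hr.le, hrl⟩)
  exact ⟨s, hs.1.lt_of_ne (by rintro rfl; exact hr.ne' hf0), rfl⟩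

theorem upperEigenspace_ne_bot_of_lt_finrank {T : H →L[ℂ] H} {s : ℝ} {k : ℕ}
    (h : k < Module.finrank ℂ (upperEigenspace T s)) : upperEigenspace T s ≠ ⊥ := by
  intro h0
  rw [h0, finrank_bot] at h
  exact absurd h (Nat.not_lt_zero k)

/-- The set whose supremum is `singularValue T k` is bounded for every bounded operator `T`, compact
or not, so the supremum is never a junk value for lack of an upper bound. -/
theorem bddAbove_singularValue (T : H →L[ℂ] H) (k : ℕ) :
    BddAbove {s : ℝ | 0 < s ∧ k < Module.finrank ℂ (upperEigenspace T s)} := by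
  refine ⟨‖T‖, fun s ⟨hs, hk⟩ => ?_⟩
  have h := upperEigenspace_ne_bot_of_lt_finrank hk
  rw [upperEigenspace, Ne, iSup_eq_bot, not_forall] at h
  obtain ⟨⟨m, hm⟩, h⟩ := h
  obtain ⟨x, hx, hx0⟩ := Submodule.exists_mem_ne_zero_of_ne_bot h
  have hx := mem_eigenspace_ofReal.1 hx
  have h1 := ContinuousLinearMap.le_opNorm
    (ContinuousLinearMap.adjoint T ∘L T : H →L[ℂ] H) x
  rw [hx, norm_smul, ContinuousLinearMap.norm_adjoint_comp_self] at h1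
  have h2 := le_of_mul_le_mul_right h1 (norm_pos_iff.2 hx0)
  have h3 : m ≤ ‖m‖ := le_abs_self m
  exact abs_le_of_sq_le_sq' (by rw [sq ‖T‖]; exact hm.trans (h3.trans h2)) (norm_nonneg T) |>.2

theorem singularValue_nonneg (T : H →L[ℂ] H) (k : ℕ) : 0 ≤ singularValue T k :=
  Real.sSup_nonneg fun _ h => h.1.le

theorem singularValue_antitone (T : H →L[ℂ] H) : Antitone (singularValue T) := by
  intro j k hjk
  rcases Set.eq_empty_or_nonempty
    {s : ℝ | 0 < s ∧ k < Module.finrank ℂ (upperEigenspace T s)} with h | h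
  · rw [singularValue, h, Real.sSup_empty]
    exact singularValue_nonneg T j
  · exact csSup_le_csSup (bddAbove_singularValue T j) h fun s hs => ⟨hs.1, hjk.trans_lt hs.2⟩

/-- For an increasing function `f` vanishing at `0`, the singular values of `f(B)` are the values of
`f` at the singular values of `B`. -/
theorem singularValue_cfc (hB : 0 ≤ B) (hc : ContinuousOn f (Set.Ici 0))
    (hf : StrictMonoOn f (Set.Ici 0)) (hf0 : f 0 = 0) (k : ℕ) :
    singularValue (cfc f B) k = f (singularValue B k) := by
  have hup : ∀ s, 0 ≤ s → upperEigenspace (cfc f B) (f s) = upperEigenspace B s := by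
    intro s hs
    have h := upperEigenspace_cfc hB continuousOn_id (strictMonoOn_id (s := Set.Ici 0)) rfl hs
    have hsa : IsSelfAdjoint B := .of_nonneg hB
    rw [cfc_id ℝ B] at h
    exact (upperEigenspace_cfc hB hc hf hf0 hs).trans h.symm
  have himg : {s : ℝ | 0 < s ∧ k < Module.finrank ℂ (upperEigenspace (cfc f B) s)}
      = f '' {s : ℝ | 0 < s ∧ k < Module.finrank ℂ (upperEigenspace B s)} := by
    ext r
    constructor
    · rintro ⟨hr, hk⟩
      obtain ⟨s, hs, rfl⟩ := exists_eq_of_upperEigenspace_cfc_ne_bot hB hc hf hf0 hr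
        (upperEigenspace_ne_bot_of_lt_finrank hk)
      exact ⟨s, ⟨hs, hup s hs.le ▸ hk⟩, rfl⟩
    · rintro ⟨s, ⟨hs, hk⟩, rfl⟩
      exact ⟨hf0 ▸ hf Set.self_mem_Ici hs.le hs, (hup s hs.le).symm ▸ hk⟩
  rw [singularValue, himg, singularValue]
  rcases Set.eq_empty_or_nonempty
    {s : ℝ | 0 < s ∧ k < Module.finrank ℂ (upperEigenspace B s)} with h | h
  · rw [h, Set.image_empty, Real.sSup_empty, hf0]
  · have hsub : {s : ℝ | 0 < s ∧ k < Module.finrank ℂ (upperEigenspace B s)} ⊆ Set.Ici 0 :=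
      fun s hs => hs.1.le
    exact (MonotoneOn.map_csSup_of_continuousWithinAt
      ((hc _ (singularValue_nonneg B k)).mono hsub) (hf.monotoneOn.mono hsub) h
      (bddAbove_singularValue B k)).symm

end SingularValues

/-! ### Equivalent growth conditions on a nonincreasing sequence -/

section Sequences

/-- The power sums `∑ a_k^q` are finite and `O(1 / (q - 1))` as `q ↓ 1`. For the singular values of
a compact operator this is membership in `𝒵₁`, without the exponent `1 / q`. -/
def PowerSumBound (a : ℕ → ℝ) : Prop :=
  ∃ M : ℝ, ∀ᶠ q in 𝓝[>] (1 : ℝ), Summable (fun k => a k ^ q) ∧ (q - 1) * ∑' k, a k ^ q ≤ M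

/-- The sums `∑ a_k e^{-t / a_k}` (with the term `0` where `a_k = 0`) are finite for small `t > 0`
and `O(ln t⁻¹)` as `t ↓ 0`. For the singular values of `A⁻¹` the sum is `‖A⁻¹ e^{-tA}‖₁`. -/
def HeatSumBound (a : ℕ → ℝ) : Prop :=
  (∀ᶠ t in 𝓝[>] (0 : ℝ), Summable fun k => a k * expNegDiv t (a k)) ∧
    (fun t : ℝ => ∑' k, a k * expNegDiv t (a k)) =O[𝓝[>] 0] fun t => Real.log t⁻¹

theorem rpow_mul_exp_neg_le_one {u e : ℝ} (hu : 0 ≤ u) (he0 : 0 ≤ e) (he1 : e ≤ 1) :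
    u ^ e * Real.exp (-u) ≤ 1 := by
  have h1 : u ^ e ≤ Real.exp u := by
    rcases le_total u 1 with h | h
    · exact (Real.rpow_le_one hu h he0).trans (Real.one_le_exp hu)
    · calc u ^ e ≤ u ^ (1 : ℝ) := Real.rpow_le_rpow_of_exponent_le h he1
        _ = u := Real.rpow_one u
        _ ≤ Real.exp u := by linarith [Real.add_one_le_exp u]
  calc u ^ e * Real.exp (-u) ≤ Real.exp u * Real.exp (-u) := by gcongr
    _ = 1 := by rw [← Real.exp_add, add_neg_cancel, Real.exp_zero]

/-- From `e^{-u} ≤ u^{1 - q}` at `u = t / x`. -/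
theorem mul_expNegDiv_le {x t q : ℝ} (hx : 0 ≤ x) (ht : 0 < t) (hq1 : 1 ≤ q) (hq2 : q ≤ 2) :
    x * expNegDiv t x ≤ t ^ (1 - q) * x ^ q := by
  rcases hx.eq_or_lt with rfl | hx
  · rw [zero_mul]; positivity
  rw [expNegDiv, if_neg hx.ne']
  have h := rpow_mul_exp_neg_le_one (u := t / x) (e := q - 1) (by positivity) (by linarith)
    (by linarith)
  have h1 : x = t ^ (1 - q) * x ^ q * (t / x) ^ (q - 1) := by
    rw [Real.div_rpow ht.le hx.le, mul_div_assoc', eq_div_iff (by positivity)]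
    have e1 : x * x ^ (q - 1) = x ^ q := by
      conv_lhs => rw [← Real.rpow_one x]
      rw [Real.rpow_one, ← Real.rpow_one_add' hx.le (by linarith)]
      congr 1; ring
    have e2 : t ^ (1 - q) * t ^ (q - 1) = 1 := by
      rw [← Real.rpow_add ht, show 1 - q + (q - 1) = 0 by ring, Real.rpow_zero]
    rw [e1, mul_right_comm, e2, one_mul]
  calc x * Real.exp (-t / x)
      = t ^ (1 - q) * x ^ q * (t / x) ^ (q - 1) * Real.exp (-(t / x)) := by rw [← h1, neg_div]
    _ = t ^ (1 - q) * x ^ q * ((t / x) ^ (q - 1) * Real.exp (-(t / x))) := mul_assoc _ _ _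
    _ ≤ t ^ (1 - q) * x ^ q * 1 := by gcongr
    _ = _ := mul_one _

/-- From `e^{-u} ≤ 4 u^{-q}` at `u = t / x`. -/
theorem expNegDiv_le {x t q : ℝ} (hx : 0 ≤ x) (ht : 0 < t) (hq1 : 1 ≤ q) (hq2 : q ≤ 2) :
    expNegDiv t x ≤ 4 * t ^ (-q) * x ^ q := by
  rcases hx.eq_or_lt with rfl | hx
  · rw [expNegDiv, if_pos rfl]; positivity
  rw [expNegDiv, if_neg hx.ne']
  set u := t / x with hu
  have hu0 : 0 < u := by positivity
  -- the exponent `q` exceeds `1`, so the bound is applied at `u / 2` with `q / 2`, and squared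
  have h := rpow_mul_exp_neg_le_one (u := u / 2) (e := q / 2) (by positivity) (by linarith)
    (by linarith)
  have h2 : u ^ q * Real.exp (-u) ≤ 4 := by
    have e1 : u ^ q = 2 ^ q * ((u / 2) ^ (q / 2)) ^ 2 := by
      rw [← Real.rpow_natCast, ← Real.rpow_mul (by positivity), Nat.cast_two,
        div_mul_cancel₀ _ two_ne_zero, ← Real.mul_rpow two_pos.le (by positivity)]
      congr 1; ring
    have e2 : Real.exp (-u) = Real.exp (-(u / 2)) ^ 2 := by
      rw [← Real.exp_nat_mul]; congr 1; push_cast; ring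
    have e3 : (2 : ℝ) ^ q ≤ 4 := by
      calc (2 : ℝ) ^ q ≤ 2 ^ (2 : ℝ) := Real.rpow_le_rpow_of_exponent_le one_le_two hq2
        _ = 4 := by norm_num
    calc u ^ q * Real.exp (-u) = 2 ^ q * ((u / 2) ^ (q / 2) * Real.exp (-(u / 2))) ^ 2 := by
          rw [e1, e2]; ring
      _ ≤ 4 * 1 ^ 2 := by gcongr
      _ = 4 := by norm_num
  have h3 : u ^ q = (t ^ (-q) * x ^ q)⁻¹ := by
    rw [hu, Real.div_rpow ht.le hx.le, Real.rpow_neg ht.le, mul_inv, inv_inv]; rfl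
  rw [h3, inv_mul_le_iff₀ (by positivity)] at h2
  rw [neg_div, ← hu]
  linarith

variable {a : ℕ → ℝ}

theorem PowerSumBound.exists_summable_rpow (h : PowerSumBound a) :
    ∃ q : ℝ, 1 ≤ q ∧ q ≤ 2 ∧ Summable fun k => a k ^ q := by
  obtain ⟨M, hM⟩ := h
  obtain ⟨q, hq, hq1, hq2⟩ := (hM.and (Ioc_mem_nhdsGT (show (1 : ℝ) < 2 by norm_num))).exists
  exact ⟨q, hq1.le, hq2, hq.1⟩

theorem mul_expNegDiv_nonneg {x t : ℝ} (hx : 0 ≤ x) (ht : 0 < t) : 0 ≤ x * expNegDiv t x :=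
  mul_nonneg hx (expNegDiv_bounds ht hx).1

theorem PowerSumBound.summable_mul_expNegDiv (ha : ∀ k, 0 ≤ a k) (h : PowerSumBound a) {t : ℝ}
    (ht : 0 < t) : Summable fun k => a k * expNegDiv t (a k) := by
  obtain ⟨q, hq1, hq2, hq⟩ := h.exists_summable_rpow
  exact .of_nonneg_of_le (fun k => mul_expNegDiv_nonneg (ha k) ht)
    (fun k => mul_expNegDiv_le (ha k) ht hq1 hq2) (hq.mul_left _)

theorem PowerSumBound.summable_expNegDiv (ha : ∀ k, 0 ≤ a k) (h : PowerSumBound a) {t : ℝ}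
    (ht : 0 < t) : Summable fun k => expNegDiv t (a k) := by
  obtain ⟨q, hq1, hq2, hq⟩ := h.exists_summable_rpow
  exact .of_nonneg_of_le (fun k => (expNegDiv_bounds ht (ha k)).1)
    (fun k => expNegDiv_le (ha k) ht hq1 hq2) (hq.mul_left _)

theorem tendsto_log_inv_nhdsGT_zero : Tendsto (fun t : ℝ => Real.log t⁻¹) (𝓝[>] 0) atTop :=
  Real.tendsto_log_atTop.comp tendsto_inv_nhdsGT_zero

/-- The exponent `q = 1 + 1 / ln t⁻¹` makes `t^{1 - q} = e` while `1 / (q - 1) = ln t⁻¹`. -/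
theorem PowerSumBound.heatSumBound (ha : ∀ k, 0 ≤ a k) (h : PowerSumBound a) :
    HeatSumBound a := by
  refine ⟨eventually_nhdsWithin_of_forall fun t ht => h.summable_mul_expNegDiv ha ht, ?_⟩
  obtain ⟨M, hM⟩ := h
  -- the exponent `1 + 1 / ln t⁻¹` tends to `1` from the right
  have hlim : Tendsto (fun t : ℝ => 1 + (Real.log t⁻¹)⁻¹) (𝓝[>] 0) (𝓝[>] 1) := by
    refine tendsto_nhdsWithin_iff.2 ⟨?_, ?_⟩
    · simpa using (tendsto_log_inv_nhdsGT_zero.inv_tendsto_atTop).const_add (1 : ℝ)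
    · filter_upwards [tendsto_log_inv_nhdsGT_zero.eventually_gt_atTop 0] with t ht
      exact lt_add_of_pos_right 1 (inv_pos.2 ht)
  refine Asymptotics.IsBigO.of_bound (Real.exp 1 * M) ?_
  filter_upwards [hlim.eventually hM, tendsto_log_inv_nhdsGT_zero.eventually_ge_atTop 1,
    self_mem_nhdsWithin] with t hMt hlog ht
  set L := Real.log t⁻¹ with hL
  have hL0 : 0 < L := one_pos.trans_le hlog
  have hLi : L⁻¹ ≤ 1 := inv_le_one_of_one_le₀ hlog
  obtain ⟨hs, hb⟩ := hMt
  rw [add_sub_cancel_left, inv_mul_le_iff₀ hL0] at hb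
  have hnn := fun k => mul_expNegDiv_nonneg (ha k) ht
  have hle := fun k => mul_expNegDiv_le (q := 1 + L⁻¹) (ha k) ht
    (by linarith [inv_pos.2 hL0]) (by linarith)
  have ht1 : t ^ (1 - (1 + L⁻¹)) = Real.exp 1 := by
    rw [Real.rpow_def_of_pos ht, show Real.log t = -L by rw [hL, Real.log_inv, neg_neg]]
    congr 1
    field_simp
    ring
  rw [ht1] at hle
  rw [Real.norm_of_nonneg (tsum_nonneg hnn), Real.norm_of_nonneg hL0.le]
  calc ∑' k, a k * expNegDiv t (a k) ≤ ∑' k, Real.exp 1 * a k ^ (1 + L⁻¹) :=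
        (Summable.of_nonneg_of_le hnn hle (hs.mul_left _)).tsum_le_tsum hle (hs.mul_left _)
    _ = Real.exp 1 * ∑' k, a k ^ (1 + L⁻¹) := tsum_mul_left
    _ ≤ Real.exp 1 * (L * M) := by gcongr
    _ = Real.exp 1 * M * L := by ring

theorem le_exp_one_mul_expNegDiv_add {x t : ℝ} (hx : 0 ≤ x) (ht : 0 < t) :
    x ≤ Real.exp 1 * (x * expNegDiv t x) + t := by
  have h0 := mul_expNegDiv_nonneg hx ht
  rcases le_total x t with h | h
  · have : 0 ≤ Real.exp 1 * (x * expNegDiv t x) := by positivity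
    linarith
  · have hx0 : 0 < x := ht.trans_le h
    have h1 : Real.exp (-1) ≤ expNegDiv t x := by
      rw [expNegDiv, if_neg hx0.ne', Real.exp_le_exp, neg_div, neg_le_neg_iff, div_le_one hx0]
      exact h
    have h2 : x = Real.exp 1 * (x * Real.exp (-1)) := by
      rw [mul_left_comm, ← Real.exp_add]; simp
    calc x = Real.exp 1 * (x * Real.exp (-1)) := h2
      _ ≤ Real.exp 1 * (x * expNegDiv t x) := by gcongr
      _ ≤ _ := le_add_of_nonneg_right ht.le

/-- At time `t = 1 / (1 + n)` each of the first `n` terms satisfies `a_k ≤ e a_k e^{-t / a_k} + t`, and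
the `n` errors `t` add up to at most `1`. -/
theorem HeatSumBound.sum_isBigO (ha : ∀ k, 0 ≤ a k) (h : HeatSumBound a) :
    (fun n : ℕ => ∑ k ∈ Finset.range n, a k) =O[atTop] fun n : ℕ => Real.log (1 + n) := by
  obtain ⟨hs, hO⟩ := h
  obtain ⟨C, hC⟩ := hO.bound
  have hlim : Tendsto (fun n : ℕ => (1 + n : ℝ)⁻¹) atTop (𝓝[>] 0) :=
    tendsto_inv_atTop_nhdsGT_zero.comp
      (tendsto_atTop_add_const_left _ _ tendsto_natCast_atTop_atTop)
  have hlog : Tendsto (fun n : ℕ => Real.log (1 + n)) atTop atTop :=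
    Real.tendsto_log_atTop.comp (tendsto_atTop_add_const_left _ _ tendsto_natCast_atTop_atTop)
  refine Asymptotics.IsBigO.of_bound (Real.exp 1 * C + 1) ?_
  filter_upwards [hlim.eventually hs, hlim.eventually hC, hlog.eventually_ge_atTop 1]
    with n hsn hCn hn
  have ht : (0 : ℝ) < (1 + n : ℝ)⁻¹ := by positivity
  have hnn := fun k => mul_expNegDiv_nonneg (ha k) ht
  rw [inv_inv, Real.norm_of_nonneg (tsum_nonneg hnn), Real.norm_of_nonneg (by linarith)] at hCn
  rw [Real.norm_of_nonneg (Finset.sum_nonneg fun k _ => ha k), Real.norm_of_nonneg (by linarith)]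
  have h1 : (n : ℝ) * (1 + n : ℝ)⁻¹ ≤ 1 := by
    rw [← div_eq_mul_inv, div_le_one (by positivity)]; linarith
  calc ∑ k ∈ Finset.range n, a k
      ≤ ∑ k ∈ Finset.range n,
          (Real.exp 1 * (a k * expNegDiv (1 + n : ℝ)⁻¹ (a k)) + (1 + n : ℝ)⁻¹) :=
        Finset.sum_le_sum fun k _ => le_exp_one_mul_expNegDiv_add (ha k) ht
    _ = Real.exp 1 * ∑ k ∈ Finset.range n, a k * expNegDiv (1 + n : ℝ)⁻¹ (a k)
          + n * (1 + n : ℝ)⁻¹ := by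
        rw [Finset.sum_add_distrib, Finset.mul_sum, Finset.sum_const, Finset.card_range,
          nsmul_eq_mul]
    _ ≤ Real.exp 1 * (C * Real.log (1 + n)) + 1 := by
        gcongr
        exact (hsn.sum_le_tsum _ fun k _ => hnn k).trans hCn
    _ ≤ (Real.exp 1 * C + 1) * Real.log (1 + n) := by linarith

/-- Summation by parts: an inequality between all partial sums survives multiplication by
nonincreasing nonnegative weights. -/
theorem sum_mul_le_sum_mul_of_antitone {b w : ℕ → ℝ} (hw : Antitone w) (hw0 : ∀ k, 0 ≤ w k)
    (hab : ∀ n, ∑ k ∈ Finset.range n, a k ≤ ∑ k ∈ Finset.range n, b k) (n : ℕ) :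
    ∑ k ∈ Finset.range n, a k * w k ≤ ∑ k ∈ Finset.range n, b k * w k := by
  -- the left side is the boundary term of the summation by parts
  have key : ∀ n, (∑ k ∈ Finset.range (n + 1), (b k - a k)) * w n
      ≤ ∑ k ∈ Finset.range (n + 1), (b k - a k) * w k := by
    intro n
    induction n with
    | zero => simp
    | succ n ih =>
      have h0 : 0 ≤ ∑ k ∈ Finset.range (n + 1), (b k - a k) := by
        rw [Finset.sum_sub_distrib]; exact sub_nonneg.2 (hab _)
      rw [Finset.sum_range_succ, Finset.sum_range_succ (fun k => (b k - a k) * w k), add_mul]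
      gcongr
      exact (mul_le_mul_of_nonneg_left (hw n.le_succ) h0).trans ih
  rcases n with _ | n
  · simp
  have h0 : 0 ≤ ∑ k ∈ Finset.range (n + 1), (b k - a k) := by
    rw [Finset.sum_sub_distrib]; exact sub_nonneg.2 (hab _)
  have := (mul_nonneg h0 (hw0 n)).trans (key n)
  simp_rw [sub_mul] at this
  rw [Finset.sum_sub_distrib] at this
  exact sub_nonneg.1 this

/-- Weak majorization: summation by parts with weights `a_k^{q - 1}`, then Young's inequality
`b a^{q - 1} ≤ b^q / q + (1 - 1 / q) a^q`, whose last term is absorbed on the left. -/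
theorem sum_rpow_le_sum_rpow_of_majorized {b : ℕ → ℝ} (ha : ∀ k, 0 ≤ a k) (hanti : Antitone a)
    (hb : ∀ k, 0 ≤ b k) (hab : ∀ n, ∑ k ∈ Finset.range n, a k ≤ ∑ k ∈ Finset.range n, b k)
    {q : ℝ} (hq : 1 < q) (n : ℕ) :
    ∑ k ∈ Finset.range n, a k ^ q ≤ ∑ k ∈ Finset.range n, b k ^ q := by
  have hq0 : 0 < q := one_pos.trans hq
  have hconj := Real.HolderConjugate.conjExponent hq
  have hyoung : ∀ k, b k * a k ^ (q - 1) ≤ b k ^ q / q + (1 - q⁻¹) * a k ^ q := by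
    intro k
    have h := Real.young_inequality_of_nonneg (hb k) (Real.rpow_nonneg (ha k) (q - 1)) hconj
    rw [← Real.rpow_mul (ha k), Real.conjExponent,
      mul_div_cancel₀ _ (sub_pos.2 hq).ne'] at h
    refine h.trans_eq ?_
    congr 1
    field_simp
  have h1 : ∑ k ∈ Finset.range n, a k ^ q
      ≤ (∑ k ∈ Finset.range n, b k ^ q) / q + (1 - q⁻¹) * ∑ k ∈ Finset.range n, a k ^ q :=
    calc ∑ k ∈ Finset.range n, a k ^ q = ∑ k ∈ Finset.range n, a k * a k ^ (q - 1) := by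
          refine Finset.sum_congr rfl fun k _ => ?_
          rw [← Real.rpow_one_add' (ha k) (by linarith)]
          congr 1; ring
      _ ≤ ∑ k ∈ Finset.range n, b k * a k ^ (q - 1) :=
          sum_mul_le_sum_mul_of_antitone
            (fun i j hij => Real.rpow_le_rpow (ha j) (hanti hij) (by linarith))
            (fun k => Real.rpow_nonneg (ha k) _) hab n
      _ ≤ ∑ k ∈ Finset.range n, (b k ^ q / q + (1 - q⁻¹) * a k ^ q) :=
          Finset.sum_le_sum fun k _ => hyoung k
      _ = _ := by rw [Finset.sum_add_distrib, Finset.sum_div, Finset.mul_sum]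
  have h2 : (∑ k ∈ Finset.range n, a k ^ q) / q ≤ (∑ k ∈ Finset.range n, b k ^ q) / q := by
    rw [div_eq_mul_inv (∑ k ∈ Finset.range n, a k ^ q)]; linarith
  exact (div_le_div_iff_of_pos_right hq0).1 h2

theorem log_one_add_le_sum_inv (n : ℕ) :
    Real.log (1 + n) ≤ ∑ k ∈ Finset.range n, (1 / ((k + 1 : ℕ) : ℝ)) := by
  have h := log_add_one_le_harmonic n
  rw [harmonic] at h
  push_cast at h ⊢
  simpa [add_comm] using h

/-- Since `ln (1 + n)` is at most the `n`-th harmonic number, the sequence is majorized by a multiple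
of `1 / (k + 1)`, whose power sums are `ζ(q) ~ 1 / (q - 1)`. -/
theorem powerSumBound_of_sum_isBigO (ha : ∀ k, 0 ≤ a k) (hanti : Antitone a)
    (h : (fun n : ℕ => ∑ k ∈ Finset.range n, a k) =O[atTop] fun n : ℕ => Real.log (1 + n)) :
    PowerSumBound a := by
  obtain ⟨C, hC, hbd⟩ := Asymptotics.bound_of_isBigO_nat_atTop h
  set D := max C 1 with hD
  have hD1 : 1 ≤ D := le_max_right _ _
  have hD0 : 0 ≤ D := by linarith
  have hmaj : ∀ n, ∑ k ∈ Finset.range n, a k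
      ≤ ∑ k ∈ Finset.range n, D * (1 / ((k + 1 : ℕ) : ℝ)) := by
    intro n
    rcases Nat.eq_zero_or_pos n with rfl | hn
    · simp
    have hlog : 0 < Real.log (1 + n) := Real.log_pos (by
      have : (0 : ℝ) < n := Nat.cast_pos.2 hn
      linarith)
    have h1 := hbd hlog.ne'
    rw [Real.norm_of_nonneg (Finset.sum_nonneg fun k _ => ha k),
      Real.norm_of_nonneg hlog.le] at h1
    rw [← Finset.mul_sum]
    calc _ ≤ C * Real.log (1 + n) := h1
      _ ≤ D * Real.log (1 + n) := by gcongr; exact le_max_left _ _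
      _ ≤ _ := by gcongr; exact log_one_add_le_sum_inv n
  refine ⟨D ^ (2 : ℝ) * 2, ?_⟩
  filter_upwards [tendsto_sub_mul_tsum_nat_rpow.eventually_le_const one_lt_two,
    Ioc_mem_nhdsGT (show (1 : ℝ) < 2 by norm_num)] with q hz ⟨hq1, hq2⟩
  have hzs : Summable fun n : ℕ => 1 / (n : ℝ) ^ q := Real.summable_one_div_nat_rpow.2 hq1
  have hpart : ∀ n, ∑ k ∈ Finset.range n, a k ^ q ≤ D ^ q * ∑' n : ℕ, 1 / (n : ℝ) ^ q := by
    intro n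
    refine (sum_rpow_le_sum_rpow_of_majorized ha hanti (fun k => by positivity) hmaj hq1 n).trans ?_
    calc ∑ k ∈ Finset.range n, (D * (1 / ((k + 1 : ℕ) : ℝ))) ^ q
        = D ^ q * ∑ k ∈ Finset.range n, 1 / ((k + 1 : ℕ) : ℝ) ^ q := by
          rw [Finset.mul_sum]
          refine Finset.sum_congr rfl fun k _ => ?_
          rw [Real.mul_rpow hD0 (by positivity), Real.div_rpow zero_le_one (by positivity),
            Real.one_rpow]
      _ ≤ D ^ q * ∑ k ∈ Finset.range (n + 1), 1 / (k : ℝ) ^ q := by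
          rw [Finset.sum_range_succ']
          gcongr
          exact le_add_of_nonneg_right (by positivity)
      _ ≤ _ := by
          gcongr
          exact hzs.sum_le_tsum _ fun k _ => by positivity
  have hs : Summable fun k => a k ^ q :=
    summable_of_sum_range_le (fun k => Real.rpow_nonneg (ha k) q) hpart
  refine ⟨hs, ?_⟩
  calc (q - 1) * ∑' k, a k ^ q ≤ (q - 1) * (D ^ q * ∑' n : ℕ, 1 / (n : ℝ) ^ q) := by
        gcongr
        exact hs.tsum_le_of_sum_range_le hpart
    _ = D ^ q * ((q - 1) * ∑' n : ℕ, 1 / (n : ℝ) ^ q) := by ring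
    _ ≤ D ^ (2 : ℝ) * 2 := by
        gcongr

theorem sum_isBigO_iff_powerSumBound (ha : ∀ k, 0 ≤ a k) (hanti : Antitone a) :
    (fun n : ℕ => ∑ k ∈ Finset.range n, a k) =O[atTop] (fun n : ℕ => Real.log (1 + n)) ↔
      PowerSumBound a :=
  ⟨powerSumBound_of_sum_isBigO ha hanti, fun h => (h.heatSumBound ha).sum_isBigO ha⟩

theorem heatSumBound_iff_powerSumBound (ha : ∀ k, 0 ≤ a k) (hanti : Antitone a) :
    HeatSumBound a ↔ PowerSumBound a :=
  ⟨fun h => powerSumBound_of_sum_isBigO ha hanti (h.sum_isBigO ha), fun h => h.heatSumBound ha⟩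

theorem hasDerivAt_expNegDiv_mul (x t : ℝ) :
    HasDerivAt (fun s => -(x * expNegDiv s x)) (expNegDiv t x) t := by
  rcases eq_or_ne x 0 with rfl | hx
  · simpa [expNegDiv] using hasDerivAt_const t (0 : ℝ)
  · simp only [expNegDiv, if_neg hx]
    have h : HasDerivAt (fun s => -(x * Real.exp (-s / x))) (-(x * (Real.exp (-t / x) * (-1 / x))))
        t := ((((hasDerivAt_id' t).fun_neg.div_const x).exp).const_mul x).fun_neg
    exact h.congr_deriv (by field_simp)

theorem expNegDiv_anti {s t x : ℝ} (hx : 0 ≤ x) (hst : s ≤ t) :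
    expNegDiv t x ≤ expNegDiv s x := by
  unfold expNegDiv
  split_ifs
  · rfl
  · gcongr

/-- Termwise differentiation; on `(t / 2, ∞)` the derivatives are dominated by their values at
`t / 2`. -/
theorem PowerSumBound.hasDerivAt_tsum (ha : ∀ k, 0 ≤ a k) (h : PowerSumBound a) {t : ℝ}
    (ht : 0 < t) :
    HasDerivAt (fun s => -∑' k, a k * expNegDiv s (a k)) (∑' k, expNegDiv t (a k)) t := by
  have ht2 : 0 < t / 2 := half_pos ht
  have hmem : t ∈ Set.Ioi (t / 2) := half_lt_self ht
  simp_rw [← tsum_neg]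
  refine hasDerivAt_tsum_of_isPreconnected (h.summable_expNegDiv ha ht2) isOpen_Ioi
    isPreconnected_Ioi (fun k s _ => hasDerivAt_expNegDiv_mul (a k) s) (fun k s hs => ?_)
    hmem (h.summable_mul_expNegDiv ha ht).neg hmem
  rw [Real.norm_of_nonneg (expNegDiv_bounds (ht2.trans hs) (ha k)).1]
  exact expNegDiv_anti (ha k) (le_of_lt hs)

end Sequences

/-! ### Trace norms of functions of a positive operator -/

section TraceNorm

theorem tsum_ofReal_ne_top_iff {ι : Type*} {f : ι → ℝ} (hf : ∀ i, 0 ≤ f i) :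
    ∑' i, ENNReal.ofReal (f i) ≠ ∞ ↔ Summable f := by
  refine ⟨fun h => ?_, fun h => ?_⟩
  · exact (ENNReal.summable_toReal h).congr fun i => ENNReal.toReal_ofReal (hf i)
  · rw [← ENNReal.ofReal_tsum_of_nonneg hf h]
    exact ENNReal.ofReal_ne_top

variable {H : Type*} [NormedAddCommGroup H] [InnerProductSpace ℂ H] [CompleteSpace H]

theorem trAbsPow_of_isCompactOperator {T : H →L[ℂ] H} (hT : IsCompactOperator T) (q : ℝ) :
    trAbsPow T q = ∑' k, ENNReal.ofReal (singularValue T k ^ q) := if_pos hT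

theorem isCompactOperator_of_traceNorm_lt_top {T : H →L[ℂ] H} (hT : traceNorm T < ∞) :
    IsCompactOperator T := by
  by_contra h
  rw [traceNorm, trAbsPow, if_neg h] at hT
  exact lt_irrefl _ hT

/-- The exponent `1 / q` in the definition of `𝒵₁` lies between `1 / 2` and `1` near
`q = 1`, so it does not affect boundedness. -/
theorem mem_zIdeal_one_iff {T : H →L[ℂ] H} :
    T ∈ zIdeal H 1 ↔ IsCompactOperator T ∧ PowerSumBound (singularValue T) := by
  refine and_congr_right fun hT => ?_
  have hnn : ∀ (q : ℝ) k, 0 ≤ singularValue T k ^ q := fun q k =>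
    Real.rpow_nonneg (singularValue_nonneg T k) q
  simp_rw [trAbsPow_of_isCompactOperator hT]
  constructor
  · intro h
    obtain ⟨r, hr, -⟩ := ENNReal.lt_iff_exists_nnreal_btwn.1 h
    refine ⟨(max r 1 : NNReal) ^ (2 : ℝ), ?_⟩
    filter_upwards [eventually_lt_of_limsup_lt hr,
      Ioc_mem_nhdsGT (show (1 : ℝ) < 2 by norm_num)] with q hq ⟨hq1, hq2⟩
    rw [one_div, ENNReal.rpow_inv_lt_iff (by linarith)] at hq
    have hpos : ENNReal.ofReal (q - 1) ≠ 0 := (ENNReal.ofReal_pos.2 (sub_pos.2 hq1)).ne'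
    have hs : Summable fun k => singularValue T k ^ q := by
      rw [← tsum_ofReal_ne_top_iff (hnn q)]
      rintro htop
      rw [htop, ENNReal.mul_top hpos] at hq
      exact not_top_lt hq
    refine ⟨hs, ?_⟩
    rw [← ENNReal.ofReal_tsum_of_nonneg (hnn q) hs, ← ENNReal.ofReal_mul (by linarith),
      ← ENNReal.coe_rpow_of_nonneg _ (by linarith),
      ENNReal.ofReal_lt_coe_iff (mul_nonneg (by linarith) (tsum_nonneg (hnn q)))] at hq
    refine hq.le.trans ?_
    rw [NNReal.coe_rpow]
    have h1 : (1 : ℝ) ≤ (max r 1 : NNReal) := by exact_mod_cast le_max_right r 1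
    calc (r : ℝ) ^ q ≤ ((max r 1 : NNReal) : ℝ) ^ q := by
          gcongr
          exact le_max_left r 1
      _ ≤ _ := Real.rpow_le_rpow_of_exponent_le h1 hq2
  · rintro ⟨M, hM⟩
    refine (limsup_le_of_le (a := max (ENNReal.ofReal M) 1) (by isBoundedDefault) ?_).trans_lt
      (max_lt ENNReal.ofReal_lt_top ENNReal.one_lt_top)
    filter_upwards [hM, self_mem_nhdsWithin] with q ⟨hs, hq⟩ hq1
    have hq1 : 1 < q := hq1
    rw [one_div, ENNReal.rpow_inv_le_iff (by linarith), ← ENNReal.ofReal_tsum_of_nonneg (hnn q) hs,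
      ← ENNReal.ofReal_mul (by linarith)]
    calc _ ≤ ENNReal.ofReal M := ENNReal.ofReal_le_ofReal hq
      _ ≤ max (ENNReal.ofReal M) 1 := le_max_left _ _
      _ ≤ _ := ENNReal.le_rpow_self_of_one_le (le_max_right _ _) hq1.le

theorem mem_lorentzIdeal_one_iff {T : H →L[ℂ] H} :
    T ∈ lorentzIdeal H 1 ↔ IsCompactOperator T ∧ PowerSumBound (singularValue T) := by
  refine and_congr_right fun hT => ?_
  simp_rw [Real.rpow_one]
  exact sum_isBigO_iff_powerSumBound (singularValue_nonneg T) (singularValue_antitone T)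

variable {B : H →L[ℂ] H} {f : ℝ → ℝ}

theorem traceNorm_cfc (hB : 0 ≤ B) (hc : ContinuousOn f (Set.Ici 0))
    (hf : StrictMonoOn f (Set.Ici 0)) (hf0 : f 0 = 0)
    (hcomp : IsCompactOperator (cfc f B : H →L[ℂ] H)) :
    traceNorm (cfc f B) = ∑' k, ENNReal.ofReal (f (singularValue B k)) := by
  rw [traceNorm, trAbsPow_of_isCompactOperator hcomp]
  simp_rw [Real.rpow_one, singularValue_cfc hB hc hf hf0]

theorem strictMonoOn_expNegDiv {t : ℝ} (ht : 0 < t) : StrictMonoOn (expNegDiv t) (Set.Ici 0) := by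
  intro x hx y hy hxy
  have hy0 : 0 < y := lt_of_le_of_lt hx hxy
  rcases eq_or_lt_of_le (show (0 : ℝ) ≤ x from hx) with rfl | hx0
  · rw [expNegDiv, if_pos rfl, expNegDiv, if_neg hy0.ne']
    exact Real.exp_pos _
  · rw [expNegDiv, if_neg hx0.ne', expNegDiv, if_neg hy0.ne', Real.exp_lt_exp, neg_div, neg_div,
      neg_lt_neg_iff]
    exact div_lt_div_of_pos_left ht hx0 hxy

theorem strictMonoOn_mul_expNegDiv {t : ℝ} (ht : 0 < t) :
    StrictMonoOn (fun x => x * expNegDiv t x) (Set.Ici 0) := by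
  intro x hx y hy hxy
  exact mul_lt_mul'' hxy (strictMonoOn_expNegDiv ht hx hy hxy) hx (expNegDiv_bounds ht hx).1

theorem continuousOn_mul_expNegDiv {t : ℝ} (ht : 0 < t) :
    ContinuousOn (fun x => x * expNegDiv t x) (Set.Ici 0) :=
  continuousOn_id.mul (continuousOn_expNegDiv ht)

/-- Continuity at `0`, where the quotient is `0 / 0 = 0`, holds since `e^{-t / x} = O(x²)`. -/
theorem continuousOn_expNegDiv_div {t : ℝ} (ht : 0 < t) :
    ContinuousOn (fun x => expNegDiv t x / x) (Set.Ici 0) := by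
  intro x hx
  rcases eq_or_ne x 0 with rfl | hx0
  · have h0 : Tendsto (fun x : ℝ => 4 * t ^ (-2 : ℝ) * x) (𝓝[Set.Ici 0] 0) (𝓝 0) := by
      have : Tendsto (fun x : ℝ => 4 * t ^ (-2 : ℝ) * x) (𝓝 0) (𝓝 (4 * t ^ (-2 : ℝ) * 0)) :=
        tendsto_id.const_mul _
      rw [mul_zero] at this
      exact this.mono_left nhdsWithin_le_nhds
    rw [ContinuousWithinAt, div_zero]
    refine squeeze_zero' ?_ ?_ h0
    · filter_upwards [self_mem_nhdsWithin] with y hy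
      exact div_nonneg (expNegDiv_bounds ht hy).1 hy
    · filter_upwards [self_mem_nhdsWithin] with y hy
      have hy : 0 ≤ y := hy
      refine div_le_of_le_mul₀ hy (by positivity) ?_
      refine (expNegDiv_le hy ht one_le_two le_rfl).trans_eq ?_
      rw [Real.rpow_two]; ring
  · exact (continuousOn_expNegDiv ht x hx).div continuousWithinAt_id hx0

/-- `e^{-t / x}` is `x` times a continuous function, so `e^{-tA}` is the product of a bounded operator
and the compact operator `B`. -/
theorem isCompactOperator_cfc_expNegDiv (hB : 0 ≤ B) (hcomp : IsCompactOperator B) {t : ℝ}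
    (ht : 0 < t) : IsCompactOperator (cfc (expNegDiv t) B : H →L[ℂ] H) := by
  have hsa : IsSelfAdjoint B := .of_nonneg hB
  have hsub : spectrum ℝ B ⊆ Set.Ici 0 := fun _ h => spectrum_nonneg_of_nonneg hB h
  have h : cfc (expNegDiv t) B = cfc (fun x => expNegDiv t x / x) B * B := by
    conv_rhs => rhs; rw [← cfc_id ℝ B]
    rw [← cfc_mul _ _ B ((continuousOn_expNegDiv_div ht).mono hsub)]
    refine cfc_congr fun x _ => ?_
    rcases eq_or_ne x 0 with rfl | hx
    · simp [expNegDiv]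
    · exact (div_mul_cancel₀ _ hx).symm
  rw [h]
  exact hcomp.clm_comp (cfc (fun x => expNegDiv t x / x) B)

theorem mul_cfc_expNegDiv (hB : 0 ≤ B) {t : ℝ} (ht : 0 < t) :
    B * cfc (expNegDiv t) B = cfc (fun x => x * expNegDiv t x) B := by
  have hsa : IsSelfAdjoint B := .of_nonneg hB
  have hsub : spectrum ℝ B ⊆ Set.Ici 0 := fun _ h => spectrum_nonneg_of_nonneg hB h
  rw [cfc_mul (fun x => x) (expNegDiv t) B (by fun_prop) ((continuousOn_expNegDiv ht).mono hsub),
    cfc_id' ℝ B]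

theorem traceNorm_cfc_expNegDiv (hB : 0 ≤ B) (hcomp : IsCompactOperator B) {t : ℝ}
    (ht : 0 < t) :
    traceNorm (cfc (expNegDiv t) B) = ∑' k, ENNReal.ofReal (expNegDiv t (singularValue B k)) :=
  traceNorm_cfc hB (continuousOn_expNegDiv ht) (strictMonoOn_expNegDiv ht) (if_pos rfl)
    (isCompactOperator_cfc_expNegDiv hB hcomp ht)

theorem traceNorm_mul_cfc_expNegDiv (hB : 0 ≤ B) (hcomp : IsCompactOperator B) {t : ℝ}
    (ht : 0 < t) :
    traceNorm (B * cfc (expNegDiv t) B)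
      = ∑' k, ENNReal.ofReal (singularValue B k * expNegDiv t (singularValue B k)) := by
  have h : IsCompactOperator (B * cfc (expNegDiv t) B) :=
    hcomp.comp_clm (cfc (expNegDiv t) B)
  rw [mul_cfc_expNegDiv hB ht] at h ⊢
  exact traceNorm_cfc hB (continuousOn_mul_expNegDiv ht) (strictMonoOn_mul_expNegDiv ht)
    (zero_mul _) h

/-- The convergence is in operator norm, because `0 ≤ x - x e^{-t / x} ≤ t`. -/
theorem tendsto_mul_cfc_expNegDiv (hB : 0 ≤ B) :
    Tendsto (fun t => B * cfc (expNegDiv t) B) (𝓝[>] 0) (𝓝 B) := by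
  have hsa : IsSelfAdjoint B := .of_nonneg hB
  have hsub : spectrum ℝ B ⊆ Set.Ici 0 := fun _ h => spectrum_nonneg_of_nonneg hB h
  rw [tendsto_iff_norm_sub_tendsto_zero]
  refine squeeze_zero' (Eventually.of_forall fun _ => norm_nonneg _) (g := fun t : ℝ => t) ?_
    (tendsto_id.mono_left nhdsWithin_le_nhds)
  filter_upwards [self_mem_nhdsWithin] with t ht
  have ht : 0 < t := ht
  rw [mul_cfc_expNegDiv hB ht]
  nth_rw 2 [← cfc_id' ℝ B]
  rw [← cfc_sub _ _ B ((continuousOn_mul_expNegDiv ht).mono hsub)]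
  refine norm_cfc_le ht.le fun x hx => ?_
  have h := (quotient_bounds ht (hsub hx)).1
  rw [abs_mul, abs_of_pos (inv_pos.2 ht), inv_mul_le_iff₀ ht, mul_one, abs_sub_comm] at h
  exact h

theorem toReal_tsum_ofReal {ι : Type*} {f : ι → ℝ} (hf : ∀ i, 0 ≤ f i) (hs : Summable f) :
    (∑' i, ENNReal.ofReal (f i)).toReal = ∑' i, f i := by
  rw [← ENNReal.ofReal_tsum_of_nonneg hf hs, ENNReal.toReal_ofReal (tsum_nonneg hf)]

/-- Compactness of `B` is not assumed: if `B e^{-tA}` is trace class for small `t`, then `B` is a norm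
limit of compact operators. -/
theorem mem_zIdeal_one_iff_traceNorm (hB : 0 ≤ B) :
    B ∈ zIdeal H 1 ↔
      (∀ᶠ t in 𝓝[>] (0 : ℝ), traceNorm (B * cfc (expNegDiv t) B) < ∞) ∧
      (fun t : ℝ => (traceNorm (B * cfc (expNegDiv t) B)).toReal)
        =O[𝓝[>] 0] fun t : ℝ => Real.log t⁻¹ := by
  have hnn := singularValue_nonneg B
  suffices h : IsCompactOperator B →
      (HeatSumBound (singularValue B) ↔
        (∀ᶠ t in 𝓝[>] (0 : ℝ), traceNorm (B * cfc (expNegDiv t) B) < ∞) ∧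
        (fun t : ℝ => (traceNorm (B * cfc (expNegDiv t) B)).toReal)
          =O[𝓝[>] 0] fun t : ℝ => Real.log t⁻¹) by
    rw [mem_zIdeal_one_iff, ← heatSumBound_iff_powerSumBound hnn (singularValue_antitone B)]
    refine ⟨fun hb => (h hb.1).1 hb.2, fun hb => ?_⟩
    have hcomp : IsCompactOperator B := isCompactOperator_of_tendsto
      (tendsto_mul_cfc_expNegDiv hB)
      (hb.1.mono fun t ht => isCompactOperator_of_traceNorm_lt_top ht)
    exact ⟨hcomp, (h hcomp).2 hb⟩
  intro hcomp
  have hiff : (∀ᶠ t in 𝓝[>] (0 : ℝ), traceNorm (B * cfc (expNegDiv t) B) < ∞) ↔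
      ∀ᶠ t in 𝓝[>] (0 : ℝ),
        Summable fun k => singularValue B k * expNegDiv t (singularValue B k) := by
    refine eventually_congr (eventually_nhdsWithin_of_forall fun t ht => ?_)
    rw [traceNorm_mul_cfc_expNegDiv hB hcomp ht, lt_top_iff_ne_top,
      tsum_ofReal_ne_top_iff fun k => mul_expNegDiv_nonneg (hnn k) ht]
  rw [HeatSumBound, hiff]
  refine and_congr_right fun hs => Asymptotics.isBigO_congr ?_ EventuallyEq.rfl
  filter_upwards [hs, self_mem_nhdsWithin] with t hst ht
  rw [traceNorm_mul_cfc_expNegDiv hB hcomp ht,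
    toReal_tsum_ofReal (fun k => mul_expNegDiv_nonneg (hnn k) ht) hst]

end TraceNorm

end GibbsSemigroup

open GibbsSemigroup in
theorem theorem4p10 {H : Type*} [NormedAddCommGroup H] [InnerProductSpace ℂ H] [CompleteSpace H]
    [TopologicalSpace.SeparableSpace H]
    (A : H →ₗ.[ℂ] H) (hA : IsSelfAdjoint A) (hpos : GibbsSemigroup.IsPositive A)
    (hinv : Function.Bijective A) :
    (GibbsSemigroup.inv A hA hinv ∈ GibbsSemigroup.zIdeal H 1 →
      ∀ t : ℝ, 0 < t →
        GibbsSemigroup.traceNorm (GibbsSemigroup.expNeg A hA hinv t) < ∞ ∧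
        GibbsSemigroup.traceNorm
          (GibbsSemigroup.inv A hA hinv ∘L GibbsSemigroup.expNeg A hA hinv t) < ∞ ∧
        HasDerivAt
          (fun s : ℝ => -(GibbsSemigroup.traceNorm
            (GibbsSemigroup.inv A hA hinv ∘L GibbsSemigroup.expNeg A hA hinv s)).toReal)
          (GibbsSemigroup.traceNorm (GibbsSemigroup.expNeg A hA hinv t)).toReal t) ∧
    GibbsSemigroup.zIdeal H 1 = GibbsSemigroup.lorentzIdeal H 1 ∧
    (GibbsSemigroup.inv A hA hinv ∈ GibbsSemigroup.zIdeal H 1 ↔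
      (∀ᶠ t in 𝓝[>] (0 : ℝ), GibbsSemigroup.traceNorm
          (GibbsSemigroup.inv A hA hinv ∘L GibbsSemigroup.expNeg A hA hinv t) < ∞) ∧
      (fun t : ℝ => (GibbsSemigroup.traceNorm
          (GibbsSemigroup.inv A hA hinv ∘L GibbsSemigroup.expNeg A hA hinv t)).toReal)
        =O[𝓝[>] 0] fun t : ℝ => Real.log t⁻¹) := by
  have hB : 0 ≤ GibbsSemigroup.inv A hA hinv := inv_nonneg A hA hpos hinv
  have hU : ∀ t : ℝ, 0 < t →
      expNeg A hA hinv t = cfc (expNegDiv t) (GibbsSemigroup.inv A hA hinv) :=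
    fun t ht => if_neg ht.ne'
  have hBU : ∀ t : ℝ, 0 < t → GibbsSemigroup.inv A hA hinv ∘L expNeg A hA hinv t
      = GibbsSemigroup.inv A hA hinv * cfc (expNegDiv t) (GibbsSemigroup.inv A hA hinv) :=
    fun t ht => by rw [hU t ht]; rfl
  set B := GibbsSemigroup.inv A hA hinv with hBdef
  have hnn := singularValue_nonneg B
  refine ⟨fun hz t ht => ?_, ?_, ?_⟩
  · obtain ⟨hcomp, hp⟩ := mem_zIdeal_one_iff.1 hz
    have hs := hp.summable_expNegDiv hnn ht
    have hs' := fun s (hs : 0 < s) => hp.summable_mul_expNegDiv hnn hs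
    have hnn1 := fun k => (expNegDiv_bounds ht (hnn k)).1
    have hnn2 := fun s (hs : 0 < s) k => mul_expNegDiv_nonneg (hnn k) hs
    refine ⟨?_, ?_, ?_⟩
    · rw [hU t ht, traceNorm_cfc_expNegDiv hB hcomp ht, lt_top_iff_ne_top]
      exact (tsum_ofReal_ne_top_iff hnn1).2 hs
    · rw [hBU t ht, traceNorm_mul_cfc_expNegDiv hB hcomp ht, lt_top_iff_ne_top]
      exact (tsum_ofReal_ne_top_iff (hnn2 t ht)).2 (hs' t ht)
    · rw [hU t ht, traceNorm_cfc_expNegDiv hB hcomp ht, toReal_tsum_ofReal hnn1 hs]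
      refine (hp.hasDerivAt_tsum hnn ht).congr_of_eventuallyEq ?_
      filter_upwards [lt_mem_nhds ht] with s hs0
      rw [hBU s hs0, traceNorm_mul_cfc_expNegDiv hB hcomp hs0,
        toReal_tsum_ofReal (hnn2 s hs0) (hs' s hs0)]
  · ext T
    rw [mem_zIdeal_one_iff, mem_lorentzIdeal_one_iff]
  · rw [mem_zIdeal_one_iff_traceNorm hB]
    refine and_congr (eventually_congr ?_) (Asymptotics.isBigO_congr ?_ EventuallyEq.rfl)
    · exact eventually_nhdsWithin_of_forall fun t ht => by rw [hBU t ht]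
    · exact eventually_nhdsWithin_of_forall fun t ht => by simp_rw [hBU t ht]
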